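/- Let $K$ be an algebraically closed field and let $\Lambda$ be a (basic) local finite dimensional $K$-algebra with Jacobson radical $J$ such that $J^2=0$ and $r:=\dim_K J\ge 2$; choose a $K$-basis $\alpha_1,\dots,\alpha_r$ of $J$, so that $\Lambda = KQ/\langle\text{all paths of length }2\rangle$, where $Q$ is the quiver with a single vertex and the $r$ loops $\alpha_1,\dots,\alpha_r$. Let $S$ be the unique simple left $\Lambda$-module, let $d\ge 2$, and let $u\in\mathbb N$ be minimal with respect to $ru\ge d-u$, i.e. $u=\lceil d/(r+1)\rceil$. Let $\mathbf{Rep}_d(\Lambda)$ be the affine variety, with its Zariski topology, of all sequences of $r$ matrices in $K^{d\times d}$ satisfying the relations of $\Lambda$ (that is, $A_iA_j=0$ for all $i,j$); its points $x$ correspond to the $\Lambda$-module structures $M_x$ on $K^d$. For a semisimple module $T$ let $\mathbf{Rep}^T_d\subseteq\mathbf{Rep}_d(\Lambda)$ be the set of all points $x$ with $M_x/JM_x\cong T$. Then the irreducible components of $\mathbf{Rep}_d(\Lambda)$ are precisely the closures $\overline{\mathbf{Rep}^{S^t}_d}$ with $u\le t\le d-u$, and these closures are pairwise distinct. Moreover,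 each irreducible component $\mathcal C$ of $\mathbf{Rep}_d(\Lambda)$ has a dense open subset $\mathfrak U\subseteq\mathcal C$ such that $M_x$ has no simple direct summand for any $x\in\mathfrak U$. -/

import Mathlib

noncomputable section

namespace LocalRep

/-- The Jacobson radical `J` of the `K`-algebra `Λ`, viewed as a `K`-subspace of `Λ`. -/
def radical (K Λ : Type*) [Field K] [Ring Λ] [Algebra K Λ] : Submodule K Λ :=
  (Ring.jacobson Λ).restrictScalars K

section Topology

/-- The zero locus, in the affine space with coordinates indexed by `σ`, of a set of polynomials. -/
def zeroSet {K σ : Type*} [Field K] (F : Set (MvPolynomial σ K)) : Set (σ → K) :=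
  {x | ∀ f ∈ F, MvPolynomial.eval x f = 0}

/-- The Zariski topology on the affine space with coordinates indexed by `σ`: the closed sets
are the zero loci of sets of polynomials. -/
@[reducible] def zariski (K σ : Type*) [Field K] : TopologicalSpace (σ → K) :=
  TopologicalSpace.ofClosed {Z | ∃ F : Set (MvPolynomial σ K), Z = zeroSet F}
    ⟨{1}, by ext x; simp [zeroSet]⟩
    (by
      intro A hA
      refine ⟨{f | ∃ F, zeroSet F ∈ A ∧ f ∈ F}, ?_⟩
      ext x
      constructor
      · rintro hx f ⟨F, hF, hf⟩
        exact hx _ hF f hf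
      · intro hx Z hZ
        obtain ⟨F, rfl⟩ := hA hZ
        exact fun f hf => hx f ⟨F, hZ, hf⟩)
    (by
      rintro _ ⟨F, rfl⟩ _ ⟨G, rfl⟩
      refine ⟨{h | ∃ f ∈ F, ∃ g ∈ G, h = f * g}, ?_⟩
      ext x
      constructor
      · rintro (hx | hx) h ⟨f, hf, g, hg, rfl⟩
        · simp [hx f hf]
        · simp [hx g hg]
      · intro hx
        by_contra hcon
        simp only [Set.mem_union, not_or, zeroSet, Set.mem_ofPred_eq, not_forall] at hcon
        obtain ⟨⟨f, hf, hfx⟩, ⟨g, hg, hgx⟩⟩ := hcon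
        have h := hx (f * g) ⟨f, hf, g, hg, rfl⟩
        rw [map_mul] at h
        exact (mul_ne_zero hfx hgx) h)

end Topology

section Presentation

variable {K Λ : Type*} [Field K] [Ring Λ] [Algebra K Λ] {r : ℕ}

/-- The homomorphism `KQ → Λ` determined by the arrows `α`, where `Q` is the quiver with one vertex
and `r` loops; its path algebra `KQ` is the free algebra on the loops. The kernel is the ideal `I`
of relations, so that `Λ = KQ/I`. Since we shall only consider the case `J² = 0`, the arrows form a
basis of `J = J/J²`. -/
def presentation (α : Module.Basis (Fin r) K (radical K Λ)) : FreeAlgebra K (Fin r) →ₐ[K] Λ :=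
  FreeAlgebra.lift K fun i => (α i : Λ)

/-- In a finite dimensional local algebra, every non-unit lies in the radical. -/
theorem mem_radical_of_not_isUnit [FiniteDimensional K Λ] [IsLocalRing Λ] {a : Λ}
    (ha : ¬ IsUnit a) : a ∈ radical K Λ := by
  have hleft : ∀ y : Λ, ¬ IsUnit (y * a) := by
    rintro y ⟨v, hv⟩
    apply ha
    have h1 : (↑v⁻¹ * y) * a = 1 := by rw [mul_assoc, ← hv, Units.inv_mul]
    have : IsNoetherianRing Λ := isNoetherian_of_tower K inferInstance
    have h2 : a * (↑v⁻¹ * y) = 1 := mul_eq_one_symm h1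
    exact ⟨⟨a, _, h2, h1⟩, rfl⟩
  change a ∈ Ring.jacobson Λ
  rw [← Ideal.jacobson_bot, Ideal.mem_jacobson_iff]
  intro y
  have h : IsUnit (y * a + 1) := by
    have := IsLocalRing.isUnit_or_isUnit_of_add_one
      (show (-(y * a)) + (y * a + 1) = 1 by abel)
    exact this.resolve_left fun h => hleft y (by simpa using h.neg)
  obtain ⟨v, hv⟩ := h
  refine ⟨↑v⁻¹, ?_⟩
  have : (↑v⁻¹ : Λ) * (y * a + 1) = 1 := by rw [← hv, Units.inv_mul]
  rw [Ideal.mem_bot, ← this]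
  noncomm_ring

variable [IsAlgClosed K] [FiniteDimensional K Λ] [IsLocalRing Λ]

/-- The arrows generate `Λ`. -/
theorem presentation_surjective (α : Module.Basis (Fin r) K (radical K Λ)) :
    Function.Surjective (presentation α) := by
  intro a
  obtain ⟨c, hc⟩ := spectrum.nonempty_of_isAlgClosed_of_finiteDimensional K a
  have hJ : algebraMap K Λ c - a ∈ radical K Λ := mem_radical_of_not_isUnit hc
  let z : radical K Λ := ⟨_, hJ⟩
  have hz : ∑ i, α.repr z i • (α i : Λ) = algebraMap K Λ c - a := by
    have h := congrArg (radical K Λ).subtype (α.sum_repr z)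
    rw [map_sum] at h
    simpa only [map_smul, Submodule.subtype_apply] using h
  refine ⟨algebraMap K _ c - ∑ i, α.repr z i • FreeAlgebra.ι K i, ?_⟩
  simp only [presentation, map_sub, map_sum, map_smul, FreeAlgebra.lift_ι_apply, hz,
    AlgHom.commutes]
  abel

end Presentation

section Variety

variable {K Λ : Type*} [Field K] [Ring Λ] [Algebra K Λ] {r : ℕ}

/-- The variety `Rep_d(Λ)`: sequences of `r` matrices of size `d × d`, one for each arrow, that
satisfy all the relations in the kernel `I` of `KQ → Λ`. -/
def Rep (α : Module.Basis (Fin r) K (radical K Λ)) (d : ℕ) : Type _ :=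
  {x : Fin r → Matrix (Fin d) (Fin d) K //
    ∀ p : FreeAlgebra K (Fin r), presentation α p = 0 → FreeAlgebra.lift K x p = 0}

variable {α : Module.Basis (Fin r) K (radical K Λ)} {d : ℕ}

/-- The matrix entries of a point of `Rep_d(Λ)`, as a point of affine space. -/
def Rep.coords (x : Rep α d) : Fin r × Fin d × Fin d → K :=
  fun p => x.1 p.1 p.2.1 p.2.2

/-- `Rep_d(Λ)` carries the Zariski topology of the affine space of sequences of matrices. -/
instance : TopologicalSpace (Rep α d) :=
  TopologicalSpace.induced Rep.coords (zariski K (Fin r × Fin d × Fin d))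

variable [IsAlgClosed K] [FiniteDimensional K Λ] [IsLocalRing Λ]

/-- The action of `Λ = KQ/I` on `K^d` defined by a point of `Rep_d(Λ)`. -/
def Rep.action (x : Rep α d) : Λ →ₐ[K] Matrix (Fin d) (Fin d) K :=
  (Ideal.Quotient.liftₐ (RingHom.ker (presentation α)) (FreeAlgebra.lift K x.1) x.2).comp
    (Ideal.quotientKerAlgEquivOfSurjective (presentation_surjective α)).symm.toAlgHom

/-- The arrow `α i` acts through the `i`-th matrix of the sequence. -/
theorem Rep.action_arrow (x : Rep α d) (i : Fin r) : x.action (α i : Λ) = x.1 i := by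
  have h : (α i : Λ) = presentation α (FreeAlgebra.ι K i) := by simp [presentation]
  rw [h]
  have h2 : x.action (presentation α (FreeAlgebra.ι K i)) =
      FreeAlgebra.lift K x.1 (FreeAlgebra.ι K i) := by
    unfold Rep.action
    simp only [AlgHom.comp_apply]
    erw [Ideal.quotientKerAlgEquivOfSurjective_symm_apply]
    rfl
  rw [h2, FreeAlgebra.lift_ι_apply]

/-- The left `Λ`-module corresponding to a point `x` of `Rep_d(Λ)`: the space `K^d`, on which
`Λ` acts through `x`. -/
def Rep.Mod (_x : Rep α d) : Type _ := Fin d → K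

instance (x : Rep α d) : AddCommGroup x.Mod := inferInstanceAs (AddCommGroup (Fin d → K))

instance (x : Rep α d) : Module Λ x.Mod :=
  Module.compHom (Fin d → K)
    ((Matrix.toLinAlgEquiv' (R := K) (n := Fin d)).toAlgHom.comp x.action).toRingHom

/-- The action of `Λ` on the module of `x` is multiplication of a matrix with a vector. -/
theorem Rep.smul_def (x : Rep α d) (a : Λ) (v : x.Mod) :
    a • v = (x.action a).mulVec v := rfl

end Variety

section ModuleNotions

/-- The top `M/JM` of a `Λ`-module `M`. -/
abbrev Top (Λ M : Type*) [Ring Λ] [AddCommGroup M] [Module Λ M] : Type _ :=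
  M ⧸ (Ring.jacobson Λ • (⊤ : Submodule Λ M))

/-- The `Λ`-module `M` has a simple direct summand. -/
def HasSimpleSummand (Λ M : Type*) [Ring Λ] [AddCommGroup M] [Module Λ M] : Prop :=
  ∃ N N' : Submodule Λ M, IsCompl N N' ∧ IsSimpleModule Λ N

end ModuleNotions

section Strata

variable {K Λ : Type*} [Field K] [Ring Λ] [Algebra K Λ] {r : ℕ}
  [IsAlgClosed K] [FiniteDimensional K Λ] [IsLocalRing Λ]

/-- `Rep^T_d`: the points of `Rep_d(Λ)` whose modules have top isomorphic to `T`. -/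
def RepTop (α : Module.Basis (Fin r) K (radical K Λ)) (d : ℕ)
    (T : Type*) [AddCommGroup T] [Module Λ T] : Set (Rep α d) :=
  {x | Nonempty (Top Λ x.Mod ≃ₗ[Λ] T)}

/-- Generically, the modules in the subset `C` of `Rep_d(Λ)` have the property `P`: all points of
some dense open subset of `C` have it. -/
def Generically {α : Module.Basis (Fin r) K (radical K Λ)} {d : ℕ} (C : Set (Rep α d))
    (P : Rep α d → Prop) : Prop :=
  ∃ U : Set C, IsOpen U ∧ Dense U ∧ ∀ x ∈ U, P x.1

end Strata

end LocalRep

end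

/-! Since `J² = 0`, a point is a tuple `A` of matrices with all `A i * A j = 0`, so `jointRange A ≤
jointKer A`. Here `jointRange` is `JM`, and because `Λ/J = K`, the top of `M` is determined by its
dimension `d - dim JM` (`mem_repTop_iff`).

For each `s`, let `sandwich` be the set of tuples admitting an `s`-dimensional `U` with `jointRange
≤ U ≤ jointKer`, and `balanced` the locus where both equal `U`. The sandwich is irreducible, being
parametrized by a base change and free matrix entries (`isPreirreducible_sandwich`). The balanced
locus is open by semicontinuity of rank, and for `u ≤ s ≤ d - u` an explicit tuple shows it nonempty
(`balanced_nonempty`). It is then dense in the sandwich, whose closure is a component. The stratum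
with top `S^(d-s)` lies between the two, so it has the same closure.

Dimension counts show that these sandwiches cover everything (`exists_mem_sandwich`), so there are
no other components. Distinct `s` give disjoint nonempty open balanced loci, hence distinct
closures. Balanced modules have no simple summand, as `JM` contains everything killed by `J`. -/

namespace LocalRep

open Matrix

/-! ### Joint ranges and kernels of matrix tuples, ranks, and an explicit balanced tuple. -/

section LinearAlgebra

variable {K : Type*} [Field K] {r d : ℕ}

/-- The matrices of a tuple, placed side by side. -/
def rowBlock (A : Fin r → Matrix (Fin d) (Fin d) K) : Matrix (Fin d) (Fin r × Fin d) K :=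
  of fun b p => A p.1 b p.2

/-- The matrices of a tuple, stacked on top of each other. -/
def colBlock (A : Fin r → Matrix (Fin d) (Fin d) K) : Matrix (Fin r × Fin d) (Fin d) K :=
  of fun p a => A p.1 p.2 a

/-- The sum of the images of the matrices of a tuple. -/
def jointRange (A : Fin r → Matrix (Fin d) (Fin d) K) : Submodule K (Fin d → K) :=
  LinearMap.range (rowBlock A).mulVecLin

/-- The intersection of the kernels of the matrices of a tuple. -/
def jointKer (A : Fin r → Matrix (Fin d) (Fin d) K) : Submodule K (Fin d → K) :=
  LinearMap.ker (colBlock A).mulVecLin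

theorem mem_jointKer {A : Fin r → Matrix (Fin d) (Fin d) K} {v : Fin d → K} :
    v ∈ jointKer A ↔ ∀ i, A i *ᵥ v = 0 := by
  simp only [jointKer, LinearMap.mem_ker, mulVecLin_apply]
  constructor
  · intro h i
    ext b
    exact congrFun h (i, b)
  · intro h
    ext ⟨i, b⟩
    exact congrFun (h i) b

theorem mulVec_mem_jointRange (A : Fin r → Matrix (Fin d) (Fin d) K) (i : Fin r)
    (v : Fin d → K) : A i *ᵥ v ∈ jointRange A := by
  refine ⟨fun p => if p.1 = i then v p.2 else 0, ?_⟩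
  ext b
  simp [rowBlock, mulVec, dotProduct, Fintype.sum_prod_type, Finset.sum_ite_irrel]

theorem jointRange_le {A : Fin r → Matrix (Fin d) (Fin d) K} {U : Submodule K (Fin d → K)} :
    jointRange A ≤ U ↔ ∀ i v, A i *ᵥ v ∈ U := by
  refine ⟨fun h i v => h (mulVec_mem_jointRange A i v), ?_⟩
  rintro h _ ⟨w, rfl⟩
  have : (rowBlock A).mulVecLin w = ∑ i, A i *ᵥ fun a => w (i, a) := by
    ext b
    simp [rowBlock, mulVec, dotProduct, Fintype.sum_prod_type]
  rw [this]
  exact U.sum_mem fun i _ => h i _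

theorem jointRange_le_jointKer {A : Fin r → Matrix (Fin d) (Fin d) K}
    (hA : ∀ i j, A i * A j = 0) : jointRange A ≤ jointKer A :=
  jointRange_le.2 fun i v => mem_jointKer.2 fun j => by rw [mulVec_mulVec, hA, zero_mulVec]

/-- A complement `W` of the joint kernel carries all the action, so `r` copies of `W` surject onto
the joint range. -/
theorem finrank_jointRange_le (A : Fin r → Matrix (Fin d) (Fin d) K) :
    Module.finrank K (jointRange A) + r * Module.finrank K (jointKer A) ≤ r * d := by
  obtain ⟨W, hW⟩ := (jointKer A).exists_isCompl
  have hWd : Module.finrank K (jointKer A) + Module.finrank K W = d := by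
    simpa using Submodule.finrank_add_eq_of_isCompl hW
  let f : (Fin r → W) →ₗ[K] (Fin d → K) :=
    LinearMap.lsum K (fun _ : Fin r => W) K fun i => (A i).mulVecLin ∘ₗ W.subtype
  have hle : jointRange A ≤ LinearMap.range f := by
    refine jointRange_le.2 fun i v => ?_
    have hv : v ∈ jointKer A ⊔ W := hW.sup_eq_top ▸ Submodule.mem_top
    obtain ⟨k, hk, w, hw, rfl⟩ := Submodule.mem_sup.1 hv
    refine ⟨Pi.single i ⟨w, hw⟩, ?_⟩
    rw [mulVec_add, mem_jointKer.1 hk i, zero_add]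
    simp only [f]
    rw [LinearMap.lsum_piSingle]
    rfl
  have h1 := (Submodule.finrank_mono hle).trans (LinearMap.finrank_range_le f)
  rw [Module.finrank_pi_fintype] at h1
  simp only [Finset.sum_const, Finset.card_univ, Fintype.card_fin, smul_eq_mul] at h1
  calc _ ≤ r * Module.finrank K W + r * Module.finrank K (jointKer A) := by gcongr
    _ = r * d := by rw [← mul_add, add_comm (Module.finrank K W), hWd]

/-- The quotient by the joint kernel embeds into `r` copies of the joint range. -/
theorem le_finrank_jointKer (A : Fin r → Matrix (Fin d) (Fin d) K) :
    d ≤ r * Module.finrank K (jointRange A) + Module.finrank K (jointKer A) := by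
  let f : (Fin d → K) →ₗ[K] (Fin r → jointRange A) :=
    LinearMap.pi fun i => (A i).mulVecLin.codRestrict _ (mulVec_mem_jointRange A i)
  have hker : LinearMap.ker f = jointKer A := by
    ext v
    rw [mem_jointKer, LinearMap.mem_ker]
    constructor
    · exact fun h i => congrArg Subtype.val (congrFun h i)
    · exact fun h => funext fun i => Subtype.ext (h i)
  have h1 := LinearMap.finrank_range_add_finrank_ker f
  have h2 := Submodule.finrank_le (LinearMap.range f)
  rw [Module.finrank_pi_fintype] at h2
  simp only [Finset.sum_const, Finset.card_univ, Fintype.card_fin, smul_eq_mul] at h2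
  rw [hker, Module.finrank_fin_fun] at h1
  omega

theorem finrank_jointRange (A : Fin r → Matrix (Fin d) (Fin d) K) :
    Module.finrank K (jointRange A) = (rowBlock A).rank := rfl

theorem rank_colBlock_add (A : Fin r → Matrix (Fin d) (Fin d) K) :
    (colBlock A).rank + Module.finrank K (jointKer A) = d :=
  (LinearMap.finrank_range_add_finrank_ker (colBlock A).mulVecLin).trans
    (Module.finrank_fin_fun K)

/-- The rank of a matrix is detected by the minors of the products with constant matrices. -/
theorem exists_det_ne_zero_of_le_rank {m n : Type*} [Fintype m] [Fintype n] [DecidableEq m]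
    [DecidableEq n] {A : Matrix m n K} {k : ℕ} (h : k ≤ A.rank) :
    ∃ (P : Matrix (Fin k) m K) (Q : Matrix n (Fin k) K), (P * A * Q).det ≠ 0 := by
  obtain ⟨f, hf⟩ := exists_linearIndependent_of_le_finrank h
  choose g hg using fun i => (f i).2
  let q : (Fin k → K) →ₗ[K] (n → K) := Fintype.linearCombination K g
  have hinj : LinearMap.ker (A.mulVecLin ∘ₗ q) = ⊥ := by
    have hf' : LinearIndependent K fun i => (f i : m → K) :=
      hf.map' (LinearMap.range A.mulVecLin).subtype (Submodule.ker_subtype _)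
    rw [← LinearMap.ker_eq_bot.2 hf'.fintypeLinearCombination_injective]
    congr 1
    ext i : 2
    simp [q, Fintype.linearCombination_apply, hg, -mulVecLin_apply]
  -- `q` selects preimages of independent vectors in the image of `A`; a left inverse of `A ∘ q`
  -- makes the product the identity matrix.
  obtain ⟨p, hp⟩ := (A.mulVecLin ∘ₗ q).exists_leftInverse_of_injective hinj
  refine ⟨LinearMap.toMatrix' p, LinearMap.toMatrix' q, ?_⟩
  have : LinearMap.toMatrix' p * A * LinearMap.toMatrix' q = 1 := by
    have hA : LinearMap.toMatrix' A.mulVecLin = A := LinearMap.toMatrix'_toLin' A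
    nth_rw 1 [Matrix.mul_assoc, ← hA, ← LinearMap.toMatrix'_comp,
      ← LinearMap.toMatrix'_comp, hp, LinearMap.toMatrix'_id]
  rw [this, det_one]
  exact one_ne_zero

theorem le_rank_of_det_ne_zero {m n : Type*} [Fintype m] [Fintype n] {A : Matrix m n K} {k : ℕ}
    {P : Matrix (Fin k) m K} {Q : Matrix n (Fin k) K} (h : (P * A * Q).det ≠ 0) :
    k ≤ A.rank := by
  have h1 : (P * A * Q).rank = k := by
    rw [rank_of_isUnit _ ((isUnit_iff_isUnit_det _).2 h.isUnit), Fintype.card_fin]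
  rw [← h1]
  exact (rank_mul_le_left _ _).trans (rank_mul_le_right _ _)

/-- The projection onto the span of the first `s` basis vectors. -/
def headProj (K : Type*) [Field K] (d s : ℕ) : Matrix (Fin d) (Fin d) K :=
  diagonal fun a => if (a : ℕ) < s then 1 else 0

theorem headProj_mul_self (s : ℕ) : headProj K d s * headProj K d s = headProj K d s := by
  simp [headProj, diagonal_mul_diagonal]

theorem rank_headProj {s : ℕ} (hs : s ≤ d) : (headProj K d s).rank = s := by
  classical
  rw [headProj, Matrix.rank_diagonal]
  simp only [ne_eq, ite_eq_right_iff, one_ne_zero, imp_false, not_not]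
  rw [Fintype.card_subtype]
  have := Fin.card_filter_val_lt (n := d) (m := s)
  omega

theorem mem_range_headProj {s : ℕ} {v : Fin d → K} :
    v ∈ LinearMap.range (headProj K d s).mulVecLin ↔ ∀ a : Fin d, s ≤ a → v a = 0 := by
  constructor
  · rintro ⟨w, rfl⟩ a ha
    simp [headProj, mulVec_diagonal, not_lt.2 ha]
  · intro h
    refine ⟨v, ?_⟩
    ext a
    by_cases ha : (a : ℕ) < s
    · simp [headProj, mulVec_diagonal, ha]
    · simp [headProj, mulVec_diagonal, ha, h a (not_lt.1 ha)]

theorem headProj_mulVec_of_mem {s : ℕ} {v : Fin d → K}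
    (hv : v ∈ LinearMap.range (headProj K d s).mulVecLin) : headProj K d s *ᵥ v = v := by
  obtain ⟨w, rfl⟩ := hv
  simp [headProj_mul_self]

/-- The general linear group acts transitively on the subspaces of given dimension. -/
theorem exists_linearEquiv_map_eq {V : Type*} [AddCommGroup V] [Module K V]
    [FiniteDimensional K V] {U U' : Submodule K V}
    (h : Module.finrank K U = Module.finrank K U') : ∃ e : V ≃ₗ[K] V, U.map e.toLinearMap = U' := by
  obtain ⟨W, hW⟩ := U.exists_isCompl
  obtain ⟨W', hW'⟩ := U'.exists_isCompl
  have h1 := Submodule.finrank_add_eq_of_isCompl hW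
  have h2 := Submodule.finrank_add_eq_of_isCompl hW'
  let eU : U ≃ₗ[K] U' := LinearEquiv.ofFinrankEq _ _ h
  let eW : W ≃ₗ[K] W' := LinearEquiv.ofFinrankEq _ _ (by omega)
  let e := (Submodule.prodEquivOfIsCompl U W hW).symm ≪≫ₗ (eU.prodCongr eW) ≪≫ₗ
    Submodule.prodEquivOfIsCompl U' W' hW'
  have he : ∀ u : U, e u = eU u := fun u => by
    simp [e]
  refine ⟨e, le_antisymm ?_ ?_⟩
  · rintro _ ⟨u, hu, rfl⟩
    have := he ⟨u, hu⟩
    simp only [LinearEquiv.coe_coe]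
    rw [this]
    exact (eU _).2
  · intro u hu
    refine ⟨eU.symm ⟨u, hu⟩, (eU.symm _).2, ?_⟩
    simp [he]

theorem exists_le_le_finrank_eq {V : Type*} [AddCommGroup V] [Module K V]
    [FiniteDimensional K V] {A B : Submodule K V} (hAB : A ≤ B) {n : ℕ}
    (hA : Module.finrank K A ≤ n) (hB : n ≤ Module.finrank K B) :
    ∃ U, A ≤ U ∧ U ≤ B ∧ Module.finrank K U = n := by
  induction n, hA using Nat.le_induction with
  | base => exact ⟨A, le_rfl, hAB, rfl⟩
  | succ n _ ih =>
    obtain ⟨U, hAU, hUB, hU⟩ := ih (by omega)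
    obtain ⟨v, hvB, hvU⟩ : ∃ v ∈ B, v ∉ U := by
      by_contra! hcon
      have := Submodule.finrank_mono (show B ≤ U from hcon)
      omega
    refine ⟨U ⊔ Submodule.span K {v}, hAU.trans le_sup_left,
      sup_le hUB ((Submodule.span_singleton_le_iff_mem _ _).2 hvB), ?_⟩
    rw [Submodule.finrank_sup_span_singleton hvU, hU]

/-- A tuple of matrices for which the joint range and the joint kernel coincide and are spanned by
the first `s` basis vectors, for suitable `s`. -/
def balancedTuple (K : Type*) [Field K] (r d s : ℕ) (i : Fin r) : Matrix (Fin d) (Fin d) K :=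
  of fun b a => if (b : ℕ) < s ∧ s ≤ a ∧
    ((b : ℕ) = (a - s) + i * (d - s) ∨ (a : ℕ) - s = b + i * s) then 1 else 0

theorem balancedTuple_mul (s : ℕ) (i j : Fin r) :
    balancedTuple K r d s i * balancedTuple K r d s j = 0 := by
  ext b a
  rw [mul_apply]
  refine Finset.sum_eq_zero fun c _ => ?_
  by_cases hc : (c : ℕ) < s
  · simp [balancedTuple, hc, not_le.2 hc]
  · simp [balancedTuple, hc]

/-- The top right `s × (d - s)` block of the `i`-th matrix carries an identity pattern shifted down
by `i * (d - s)`. If the block is tall, division with remainder of `b` by `d - s` selects the shift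
and the column; otherwise `i = 0` suffices. -/
theorem balancedTuple_exists_col {s : ℕ} (hr : 0 < r) (hsd : s < d) (h : s ≤ r * (d - s))
    (b : Fin d) (hb : (b : ℕ) < s) : ∃ (i : Fin r) (a : Fin d), ∀ b' : Fin d,
      balancedTuple K r d s i b' a = if b' = b then 1 else 0 := by
  rcases le_total (d - s) s with hs | hs
  · have ht : 0 < d - s := by omega
    have hi : (b : ℕ) / (d - s) < r := Nat.div_lt_of_lt_mul (by rw [mul_comm]; omega)
    have hm := Nat.mod_lt (b : ℕ) ht
    have hdm := Nat.mod_add_div (b : ℕ) (d - s)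
    rw [mul_comm] at hdm
    refine ⟨⟨_, hi⟩, ⟨s + b % (d - s), by omega⟩, fun b' => ?_⟩
    simp only [balancedTuple, of_apply, Nat.add_sub_cancel_left, hdm, Nat.le_add_right, true_and]
    refine if_congr ?_ rfl rfl
    rw [Fin.ext_iff]
    refine ⟨?_, fun h => ⟨h ▸ hb, Or.inl h⟩⟩
    rintro ⟨h1, h2 | h2⟩
    · exact h2
    -- The other clause of the definition adds no extra entry: for shift zero both clauses agree,
    -- and for a positive shift it would force a column index at least `s ≥ d - s`.
    · rcases Nat.eq_zero_or_pos ((b : ℕ) / (d - s)) with h0 | h0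
      · rw [h0] at h2 hdm
        omega
      · have := Nat.le_mul_of_pos_left s h0
        omega
  · refine ⟨⟨0, hr⟩, ⟨s + b, by omega⟩, fun b' => ?_⟩
    simp only [balancedTuple, of_apply]
    refine if_congr ?_ rfl rfl
    rw [Fin.ext_iff]
    omega

/-- The transposed argument: for a wide block, the patterns shifted right by `i * s` reach every
column. -/
theorem balancedTuple_exists_row {s : ℕ} (hr : 0 < r) (hs0 : 0 < s) (h : d ≤ r * s + s)
    (a : Fin d) (ha : s ≤ a) : ∃ (i : Fin r) (b : Fin d), ∀ a' : Fin d,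
      balancedTuple K r d s i b a' = if a' = a then 1 else 0 := by
  have had := a.2
  rcases le_total s (d - s) with hs | hs
  · have hi : (a - s : ℕ) / s < r := Nat.div_lt_of_lt_mul (by rw [mul_comm]; omega)
    have hm := Nat.mod_lt (a - s : ℕ) hs0
    have hdm := Nat.mod_add_div (a - s : ℕ) s
    rw [mul_comm] at hdm
    refine ⟨⟨_, hi⟩, ⟨(a - s : ℕ) % s, by omega⟩, fun a' => ?_⟩
    simp only [balancedTuple, of_apply, hdm, hm, true_and]
    refine if_congr ?_ rfl rfl
    rw [Fin.ext_iff]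
    refine ⟨?_, fun h => ⟨h ▸ ha, Or.inr (by rw [h])⟩⟩
    rintro ⟨h1, h2 | h2⟩
    · rcases Nat.eq_zero_or_pos ((a - s : ℕ) / s) with h0 | h0
      · rw [h0] at h2 hdm
        omega
      · have := Nat.le_mul_of_pos_left (d - s) h0
        omega
    · omega
  · refine ⟨⟨0, hr⟩, ⟨a - s, by omega⟩, fun a' => ?_⟩
    simp only [balancedTuple, of_apply]
    refine if_congr ?_ rfl rfl
    rw [Fin.ext_iff]
    have := a'.2
    omega

theorem le_finrank_jointRange_balancedTuple {s : ℕ} (hr : 0 < r) (hsd : s < d)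
    (h : s ≤ r * (d - s)) : s ≤ Module.finrank K (jointRange (balancedTuple K r d s)) := by
  conv_lhs => rw [← rank_headProj (K := K) hsd.le]
  refine Submodule.finrank_mono fun v hv => ?_
  rw [mem_range_headProj] at hv
  rw [pi_eq_sum_univ' v]
  refine Submodule.sum_mem _ fun b _ => ?_
  by_cases hb : (b : ℕ) < s
  · obtain ⟨i, a, hia⟩ := balancedTuple_exists_col (K := K) hr hsd h b hb
    refine Submodule.smul_mem _ _ ?_
    convert mulVec_mem_jointRange (balancedTuple K r d s) i (Pi.single a 1) using 1
    ext b'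
    simp [hia, Pi.single_apply, eq_comm]
  · rw [hv b (not_lt.1 hb), zero_smul]
    exact Submodule.zero_mem _

theorem finrank_jointKer_balancedTuple_le {s : ℕ} (hr : 0 < r) (hsd : s < d) (hs0 : 0 < s)
    (h : d ≤ r * s + s) : Module.finrank K (jointKer (balancedTuple K r d s)) ≤ s := by
  conv_rhs => rw [← rank_headProj (K := K) hsd.le]
  refine Submodule.finrank_mono fun v hv => ?_
  refine mem_range_headProj.2 fun a ha => ?_
  obtain ⟨i, b, hib⟩ := balancedTuple_exists_row (K := K) hr hs0 h a ha
  simpa [mulVec, dotProduct, hib] using congrFun (mem_jointKer.1 hv i) b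

end LinearAlgebra

/-! ### Points of the variety as tuples with vanishing products. -/

section Points

variable {K Λ : Type*} [Field K] [Ring Λ] [Algebra K Λ] {r d : ℕ}
  {α : Module.Basis (Fin r) K (radical K Λ)}

theorem Rep.mul_eq_zero (hJ : ∀ a ∈ Ring.jacobson Λ, ∀ b ∈ Ring.jacobson Λ, a * b = 0)
    (x : Rep α d) (i j : Fin r) : x.1 i * x.1 j = 0 := by
  simpa using x.2 (FreeAlgebra.ι K i * FreeAlgebra.ι K j)
    (by simpa [presentation] using hJ _ (α i).2 _ (α j).2)

theorem affine_mul_affine {ι B : Type*} [Fintype ι] [Ring B] [Algebra K B] {e : ι → B}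
    (he : ∀ i j, e i * e j = 0) (c c' : K) (f f' : ι → K) :
    (algebraMap K B c + ∑ i, f i • e i) * (algebraMap K B c' + ∑ i, f' i • e i) =
      algebraMap K B (c * c') + ∑ i, (c * f' i + c' * f i) • e i := by
  have h0 : (∑ i, f i • e i) * (∑ i, f' i • e i) = 0 := by
    simp [Finset.sum_mul, Finset.mul_sum, he]
  rw [add_mul, mul_add, mul_add, h0, map_mul, add_zero, add_assoc]
  congr 1
  simp only [add_smul, mul_smul, Finset.sum_add_distrib, ← Finset.smul_sum]
  rw [← Algebra.commutes, ← Algebra.smul_def, ← Algebra.smul_def]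

/-- Monomials of degree at least two die on both sides, so only the constant and linear coefficients
of `p` survive, and they are the same in both algebras. This transfers relations from `Λ` to
matrices. -/
theorem exists_affine_form {X B B' : Type*} [Fintype X] [Ring B] [Algebra K B] [Ring B']
    [Algebra K B'] {e : X → B} {e' : X → B'} (he : ∀ i j, e i * e j = 0)
    (he' : ∀ i j, e' i * e' j = 0) (p : FreeAlgebra K X) :
    ∃ (c : K) (f : X → K), FreeAlgebra.lift K e p = algebraMap K B c + ∑ i, f i • e i ∧
      FreeAlgebra.lift K e' p = algebraMap K B' c + ∑ i, f i • e' i := by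
  classical
  induction p using FreeAlgebra.induction with
  | grade0 c => exact ⟨c, 0, by simp, by simp⟩
  | grade1 i => exact ⟨0, Pi.single i 1, by simp [Pi.single_apply], by simp [Pi.single_apply]⟩
  | mul p q hp hq =>
    obtain ⟨c, f, h1, h2⟩ := hp
    obtain ⟨c', f', h1', h2'⟩ := hq
    exact ⟨c * c', fun i => c * f' i + c' * f i,
      by rw [map_mul, h1, h1', affine_mul_affine he],
      by rw [map_mul, h2, h2', affine_mul_affine he']⟩
  | add p q hp hq =>
    obtain ⟨c, f, h1, h2⟩ := hp
    obtain ⟨c', f', h1', h2'⟩ := hq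
    refine ⟨c + c', f + f', ?_, ?_⟩
    · simp only [map_add, h1, h1', Pi.add_apply, add_smul, Finset.sum_add_distrib]
      abel
    · simp only [map_add, h2, h2', Pi.add_apply, add_smul, Finset.sum_add_distrib]
      abel

theorem algebraMap_mem_radical [Nontrivial Λ] {c : K} (h : algebraMap K Λ c ∈ radical K Λ) :
    c = 0 := by
  by_contra hc
  have h1 : (1 : Λ) ∈ Ring.jacobson Λ := by
    have := (radical K Λ).smul_mem c⁻¹ h
    rw [Algebra.smul_def, ← map_mul, inv_mul_cancel₀ hc, map_one] at this
    exact this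
  have h2 : Ring.jacobson Λ < ⊤ := Ring.jacobson_lt_top Λ
  exact h2.ne ((Ideal.eq_top_iff_one _).2 h1)

/-- A tuple of matrices with vanishing products is a point of `Rep_d(Λ)` if `J² = 0`. -/
def Rep.ofMul [Nontrivial Λ]
    (hJ : ∀ a ∈ Ring.jacobson Λ, ∀ b ∈ Ring.jacobson Λ, a * b = 0)
    (α : Module.Basis (Fin r) K (radical K Λ)) (A : Fin r → Matrix (Fin d) (Fin d) K)
    (hA : ∀ i j, A i * A j = 0) : Rep α d :=
  ⟨A, fun p hp => by
    obtain ⟨c, f, h1, h2⟩ := exists_affine_form (fun i j => hJ _ (α i).2 _ (α j).2) hA p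
    have hs : ∑ i, f i • (α i : Λ) ∈ radical K Λ :=
      Submodule.sum_mem _ fun i _ => Submodule.smul_mem _ _ (α i).2
    have h0 : algebraMap K Λ c + ∑ i, f i • (α i : Λ) = 0 := h1.symm.trans hp
    have hc : c = 0 := by
      refine algebraMap_mem_radical (Λ := Λ) ?_
      rw [eq_neg_of_add_eq_zero_left h0]
      exact Submodule.neg_mem _ hs
    have hf : ∑ i, f i • α i = 0 := by
      apply Subtype.ext
      rw [hc, map_zero, zero_add] at h0
      simpa using h0
    have hf' := Fintype.linearIndependent_iff.1 α.linearIndependent f hf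
    rw [h2, hc]
    simp [hf']⟩

end Points

/-! ### Open sets, irreducibility by parametrization, sandwich and balanced loci. -/

section ZariskiTopology

variable {K Λ : Type*} [Field K] [Ring Λ] [Algebra K Λ] {r d : ℕ}
  {α : Module.Basis (Fin r) K (radical K Λ)}

theorem isOpen_nonvanishing (f : MvPolynomial (Fin r × Fin d × Fin d) K) :
    IsOpen {x : Rep α d | MvPolynomial.eval x.coords f ≠ 0} := by
  refine ⟨{p | MvPolynomial.eval p f ≠ 0}, ?_, rfl⟩
  refine ⟨{f}, ?_⟩
  ext p
  simp [zeroSet]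

theorem exists_nonvanishing_subset {O : Set (Rep α d)} (hO : IsOpen O) {x : Rep α d}
    (hx : x ∈ O) : ∃ f : MvPolynomial (Fin r × Fin d × Fin d) K,
      MvPolynomial.eval x.coords f ≠ 0 ∧
        ∀ y : Rep α d, MvPolynomial.eval y.coords f ≠ 0 → y ∈ O := by
  obtain ⟨V, ⟨F, hF⟩, rfl⟩ := hO
  have hV : ∀ y : Rep α d, y.coords ∈ V ↔ ∃ f ∈ F, MvPolynomial.eval y.coords f ≠ 0 := by
    intro y
    rw [← not_iff_not, ← Set.mem_compl_iff, hF]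
    simp [zeroSet]
  obtain ⟨f, hf, hfx⟩ := (hV x).1 hx
  exact ⟨f, hfx, fun y hy => (hV y).2 ⟨f, hf, hy⟩⟩

/-- A subset of `Rep_d(Λ)` that is parametrized by polynomials on a principal open subset of an
affine space is irreducible. -/
theorem isPreirreducible_of_parametrization [Infinite K] {τ : Type*} {Y : Set (Rep α d)}
    (φ : Fin r × Fin d × Fin d → MvPolynomial τ K) (δ : MvPolynomial τ K)
    (hsurj : ∀ x ∈ Y, ∃ w : τ → K, MvPolynomial.eval w δ ≠ 0 ∧
      x.coords = fun p => MvPolynomial.eval w (φ p))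
    (hmem : ∀ w : τ → K, MvPolynomial.eval w δ ≠ 0 →
      ∃ x ∈ Y, x.coords = fun p => MvPolynomial.eval w (φ p)) : IsPreirreducible Y := by
  rintro U V hU hV ⟨x, hxY, hxU⟩ ⟨y, hyY, hyV⟩
  obtain ⟨f, hfx, hf⟩ := exists_nonvanishing_subset hU hxU
  obtain ⟨g, hgy, hg⟩ := exists_nonvanishing_subset hV hyV
  have heval : ∀ (w : τ → K) (h : MvPolynomial (Fin r × Fin d × Fin d) K),
      MvPolynomial.eval w (MvPolynomial.bind₁ φ h) =
        MvPolynomial.eval (fun p => MvPolynomial.eval w (φ p)) h := by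
    intro w h
    exact MvPolynomial.eval₂Hom_bind₁ _ _ _ _
  obtain ⟨w, hw, hxw⟩ := hsurj x hxY
  obtain ⟨v, hv, hyv⟩ := hsurj y hyY
  -- Each factor is nonzero, as witnessed by the parameters of `x` and `y`. The polynomial ring is a
  -- domain and `K` is infinite, so a single parameter point avoids all three zero loci.
  have hne : δ * MvPolynomial.bind₁ φ f * MvPolynomial.bind₁ φ g ≠ 0 := by
    refine mul_ne_zero (mul_ne_zero ?_ ?_) ?_
    · rintro rfl
      exact hw (map_zero _)
    · intro h0
      apply hfx
      rw [hxw, ← heval, h0, map_zero]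
    · intro h0
      apply hgy
      rw [hyv, ← heval, h0, map_zero]
  obtain ⟨z, hz⟩ : ∃ z, MvPolynomial.eval z (δ * MvPolynomial.bind₁ φ f *
      MvPolynomial.bind₁ φ g) ≠ 0 := by
    by_contra! hcon
    exact hne (MvPolynomial.funext fun z => by rw [hcon z, map_zero])
  rw [map_mul, map_mul] at hz
  obtain ⟨y', hy'Y, hy'⟩ := hmem z (left_ne_zero_of_mul (left_ne_zero_of_mul hz))
  refine ⟨y', hy'Y, hf _ ?_, hg _ ?_⟩
  · rw [hy', ← heval]
    exact right_ne_zero_of_mul (left_ne_zero_of_mul hz)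
  · rw [hy', ← heval]
    exact right_ne_zero_of_mul hz

/-- Matrices that depend polynomially on the points of `Rep_d(Λ)` have lower semicontinuous rank. -/
theorem isOpen_le_rank {m n : Type*} [Fintype m] [Fintype n]
    {M : Rep α d → Matrix m n K} (N : Matrix m n (MvPolynomial (Fin r × Fin d × Fin d) K))
    (hN : ∀ x : Rep α d, N.map (MvPolynomial.eval x.coords) = M x) (k : ℕ) :
    IsOpen {x | k ≤ (M x).rank} := by
  classical
  let R := MvPolynomial (Fin r × Fin d × Fin d) K
  have h : {x | k ≤ (M x).rank} = ⋃ (P : Matrix (Fin k) m K) (Q : Matrix n (Fin k) K),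
      {x | MvPolynomial.eval x.coords
        (P.map (algebraMap K R) * N * Q.map (algebraMap K R)).det ≠ 0} := by
    ext x
    have heval : ∀ (P : Matrix (Fin k) m K) (Q : Matrix n (Fin k) K),
        MvPolynomial.eval x.coords (P.map (algebraMap K R) * N *
          Q.map (algebraMap K R)).det =
          (P * M x * Q).det := by
      intro P Q
      rw [RingHom.map_det, RingHom.mapMatrix_apply, Matrix.map_mul, Matrix.map_mul, hN]
      congr 3 <;> ext <;> exact MvPolynomial.eval_C _
    simp only [Set.mem_iUnion, Set.mem_ofPred_eq, heval]
    exact ⟨exists_det_ne_zero_of_le_rank, fun ⟨_, _, h⟩ => le_rank_of_det_ne_zero h⟩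
  rw [h]
  exact isOpen_iUnion fun P => isOpen_iUnion fun Q => isOpen_nonvanishing _

/-- The points whose matrices have image in an `s`-dimensional subspace on which they vanish. -/
def sandwich (α : Module.Basis (Fin r) K (radical K Λ)) (d s : ℕ) : Set (Rep α d) :=
  {x | ∃ U : Submodule K (Fin d → K), Module.finrank K U = s ∧ jointRange x.1 ≤ U ∧
    U ≤ jointKer x.1}

/-- The points whose joint range and joint kernel coincide and have dimension `s`. -/
def balanced (α : Module.Basis (Fin r) K (radical K Λ)) (d s : ℕ) : Set (Rep α d) :=
  {x | s ≤ Module.finrank K (jointRange x.1) ∧ Module.finrank K (jointKer x.1) ≤ s}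

/-- Both inequalities are lower bounds on ranks, the one on the kernel by rank-nullity. Combined
with `jointRange ≤ jointKer`, these open conditions already force equality. -/
theorem isOpen_balanced (s : ℕ) : IsOpen (balanced α d s) := by
  have h1 : IsOpen {x : Rep α d | s ≤ (rowBlock x.1).rank} :=
    isOpen_le_rank (of fun b p => MvPolynomial.X (p.1, b, p.2))
      (fun x => by ext; simp [rowBlock, Rep.coords]) s
  have h2 : IsOpen {x : Rep α d | d - s ≤ (colBlock x.1).rank} :=
    isOpen_le_rank (of fun p a => MvPolynomial.X (p.1, p.2, a))
      (fun x => by ext; simp [colBlock, Rep.coords]) (d - s)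
  convert h1.inter h2 using 1
  ext x
  have := rank_colBlock_add x.1
  have h3 := finrank_jointRange x.1
  simp only [balanced, Set.mem_ofPred_eq, Set.mem_inter_iff]
  omega

theorem jointRange_eq_jointKer_of_mem_balanced
    (hJ : ∀ a ∈ Ring.jacobson Λ, ∀ b ∈ Ring.jacobson Λ, a * b = 0) {s : ℕ} {x : Rep α d}
    (hx : x ∈ balanced α d s) : jointRange x.1 = jointKer x.1 :=
  Submodule.eq_of_le_of_finrank_le (jointRange_le_jointKer (x.mul_eq_zero hJ)) (hx.2.trans hx.1)

theorem finrank_jointRange_of_mem_balanced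
    (hJ : ∀ a ∈ Ring.jacobson Λ, ∀ b ∈ Ring.jacobson Λ, a * b = 0) {s : ℕ} {x : Rep α d}
    (hx : x ∈ balanced α d s) : Module.finrank K (jointRange x.1) = s :=
  le_antisymm (by rw [jointRange_eq_jointKer_of_mem_balanced hJ hx]; exact hx.2) hx.1

theorem mem_sandwich_finrank_jointRange
    (hJ : ∀ a ∈ Ring.jacobson Λ, ∀ b ∈ Ring.jacobson Λ, a * b = 0) (x : Rep α d) :
    x ∈ sandwich α d (Module.finrank K (jointRange x.1)) :=
  ⟨_, rfl, le_rfl, jointRange_le_jointKer (x.mul_eq_zero hJ)⟩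

theorem balanced_subset_sandwich
    (hJ : ∀ a ∈ Ring.jacobson Λ, ∀ b ∈ Ring.jacobson Λ, a * b = 0) (s : ℕ) :
    balanced α d s ⊆ sandwich α d s := fun x hx => by
  simpa only [finrank_jointRange_of_mem_balanced hJ hx] using mem_sandwich_finrank_jointRange hJ x

theorem disjoint_balanced
    (hJ : ∀ a ∈ Ring.jacobson Λ, ∀ b ∈ Ring.jacobson Λ, a * b = 0) {s s' : ℕ} (h : s ≠ s') :
    Disjoint (balanced α d s) (balanced α d s') :=
  Set.disjoint_left.2 fun _ hx hx' => h <|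
    (finrank_jointRange_of_mem_balanced hJ hx).symm.trans
      (finrank_jointRange_of_mem_balanced hJ hx')

theorem balanced_nonempty [Nontrivial Λ]
    (hJ : ∀ a ∈ Ring.jacobson Λ, ∀ b ∈ Ring.jacobson Λ, a * b = 0) {s : ℕ} (hr : 0 < r)
    (hs0 : 0 < s) (hsd : s < d) (h1 : s ≤ r * (d - s)) (h2 : d ≤ r * s + s) :
    (balanced α d s).Nonempty :=
  ⟨Rep.ofMul hJ α (balancedTuple K r d s) (balancedTuple_mul s),
    le_finrank_jointRange_balancedTuple hr hsd h1, finrank_jointKer_balancedTuple_le hr hsd hs0 h2⟩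

/-- The two dimension bounds and `jointRange ≤ jointKer` show that both `dim jointKer` and `d - dim
jointRange` satisfy the inequality defining `u`. Hence the intervals `[dim jointRange, dim
jointKer]` and `[u, d - u]` meet. -/
theorem exists_mem_sandwich {u : ℕ}
    (hJ : ∀ a ∈ Ring.jacobson Λ, ∀ b ∈ Ring.jacobson Λ, a * b = 0)
    (hu : ∀ n, d ≤ r * n + n → u ≤ n) (hud : 2 * u ≤ d) (x : Rep α d) :
    ∃ s, u ≤ s ∧ s ≤ d - u ∧ x ∈ sandwich α d s := by
  have hle := jointRange_le_jointKer (x.mul_eq_zero hJ)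
  have h1 := finrank_jointRange_le x.1
  have h2 := le_finrank_jointKer x.1
  have h3 := Submodule.finrank_mono hle
  have h4 : Module.finrank K (jointKer x.1) ≤ d := by
    simpa using (jointKer x.1).finrank_le
  have hk : u ≤ Module.finrank K (jointKer x.1) := by
    refine hu _ (h2.trans ?_)
    gcongr
  have hi : u ≤ d - Module.finrank K (jointRange x.1) := by
    refine hu _ ?_
    obtain ⟨e, he⟩ := Nat.exists_eq_add_of_le (h3.trans h4)
    have h5 : r * Module.finrank K (jointRange x.1) ≤ r * Module.finrank K (jointKer x.1) := by
      gcongr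
    have h6 : r * d = r * Module.finrank K (jointRange x.1) + r * e := by rw [← mul_add, ← he]
    have h7 : d - Module.finrank K (jointRange x.1) = e := by omega
    rw [h7]
    omega
  -- The dimension chosen is `max (dim jointRange) u`, the smallest one allowed.
  obtain ⟨U, hU1, hU2, hU⟩ := exists_le_le_finrank_eq hle
    (le_max_left _ u) (max_le h3 hk)
  exact ⟨_, le_max_right _ _, max_le (by omega) (by omega), U, hU, hU1, hU2⟩

end ZariskiTopology

/-! ### Polynomial parametrization of the sandwich loci. -/

section Irreducibility

variable {K Λ : Type*} [Field K] [Ring Λ] [Algebra K Λ] {r d : ℕ}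
  {α : Module.Basis (Fin r) K (radical K Λ)}

/-- The tuple of matrices with parameters `g` and `B`. -/
def conjTuple {R : Type*} [CommRing R] (E g : Matrix (Fin d) (Fin d) R)
    (B : Fin r → Matrix (Fin d) (Fin d) R) (i : Fin r) : Matrix (Fin d) (Fin d) R :=
  g * E * B i * (1 - E) * g.adjugate

/-- Using the adjugate instead of the inverse keeps all entries polynomial, so a generic tuple can
be specialized along any ring homomorphism. -/
theorem conjTuple_map {R R' : Type*} [CommRing R] [CommRing R'] (f : R →+* R')
    (E g : Matrix (Fin d) (Fin d) R) (B : Fin r → Matrix (Fin d) (Fin d) R) (i : Fin r) :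
    (conjTuple E g B i).map f = conjTuple (E.map f) (g.map f) (fun j => (B j).map f) i := by
  simp only [conjTuple, ← RingHom.mapMatrix_apply, map_mul, map_sub, map_one,
    RingHom.map_adjugate]

theorem conjTuple_mul_eq_zero {R : Type*} [CommRing R] {E : Matrix (Fin d) (Fin d) R}
    (hE : E * E = E) (g : Matrix (Fin d) (Fin d) R) (B : Fin r → Matrix (Fin d) (Fin d) R)
    (i : Fin r) : conjTuple E g B i * (g * E) = 0 := by
  have h : (1 - E) * E = 0 := by rw [sub_mul, one_mul, hE, sub_self]
  calc conjTuple E g B i * (g * E)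
      = g * E * B i * (1 - E) * (g.adjugate * g) * E := by simp only [conjTuple, Matrix.mul_assoc]
    _ = g.det • (g * E * B i * ((1 - E) * E)) := by
      rw [adjugate_mul]
      simp only [Matrix.mul_smul, Matrix.smul_mul, Matrix.mul_one, Matrix.mul_assoc]
    _ = 0 := by rw [h, Matrix.mul_zero, smul_zero]

theorem conjTuple_mul_conjTuple {R : Type*} [CommRing R] {E : Matrix (Fin d) (Fin d) R}
    (hE : E * E = E) (g : Matrix (Fin d) (Fin d) R) (B : Fin r → Matrix (Fin d) (Fin d) R)
    (i j : Fin r) : conjTuple E g B i * conjTuple E g B j = 0 := by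
  calc _ = conjTuple E g B i * (g * E) * (B j * (1 - E) * g.adjugate) := by
        simp only [conjTuple, Matrix.mul_assoc]
    _ = 0 := by rw [conjTuple_mul_eq_zero hE, Matrix.zero_mul]

theorem exists_sandwich_eq_conjTuple [Nontrivial Λ]
    (hJ : ∀ a ∈ Ring.jacobson Λ, ∀ b ∈ Ring.jacobson Λ, a * b = 0) {s : ℕ} (hs : s ≤ d)
    {g : Matrix (Fin d) (Fin d) K} (hg : g.det ≠ 0) (B : Fin r → Matrix (Fin d) (Fin d) K) :
    ∃ x ∈ sandwich α d s, x.1 = conjTuple (headProj K d s) g B := by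
  have hE := headProj_mul_self (K := K) (d := d) s
  refine ⟨Rep.ofMul hJ α _ (conjTuple_mul_conjTuple hE g B),
    ⟨LinearMap.range (g * headProj K d s).mulVecLin, ?_, ?_, ?_⟩, rfl⟩
  · change (g * headProj K d s).rank = s
    rw [rank_mul_eq_right_of_isUnit_det _ _ hg.isUnit, rank_headProj hs]
  · refine jointRange_le.2 fun i v => ⟨(B i * (1 - headProj K d s) * g.adjugate) *ᵥ v, ?_⟩
    simp [Rep.ofMul, conjTuple, Matrix.mul_assoc]
  · rintro _ ⟨v, rfl⟩
    refine mem_jointKer.2 fun i => ?_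
    rw [mulVecLin_apply, mulVec_mulVec]
    simp only [Rep.ofMul]
    rw [conjTuple_mul_eq_zero hE, zero_mulVec]

/-- Take `g` carrying the span of the first `s` basis vectors to `U`. After conjugation by `g`, each
matrix has image in this span and vanishes on it, so multiplying by `E` on the left and `1 - E` on
the right changes nothing. -/
theorem exists_conjTuple_eq {s : ℕ} (hs : s ≤ d) {x : Rep α d} (hx : x ∈ sandwich α d s) :
    ∃ (g : Matrix (Fin d) (Fin d) K) (B : Fin r → Matrix (Fin d) (Fin d) K), g.det ≠ 0 ∧
      x.1 = conjTuple (headProj K d s) g B := by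
  obtain ⟨U, hU, h1, h2⟩ := hx
  obtain ⟨e, he⟩ := exists_linearEquiv_map_eq (K := K)
    (U := LinearMap.range (headProj K d s).mulVecLin) (U' := U)
    ((rank_headProj hs).trans hU.symm)
  set E := headProj K d s with hEdef
  let g := LinearMap.toMatrix' e.toLinearMap
  let g' := LinearMap.toMatrix' e.symm.toLinearMap
  have hgv : ∀ v, g *ᵥ v = e v := fun v => LinearMap.toMatrix'_mulVec _ v
  have hg'v : ∀ v, g' *ᵥ v = e.symm v := fun v => LinearMap.toMatrix'_mulVec _ v
  have hgg' : g * g' = 1 := by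
    refine Matrix.toLin'.injective (LinearMap.ext fun v => ?_)
    rw [toLin'_mul_apply]
    simp [hgv, hg'v]
  have hdet : g.det ≠ 0 := fun h => by
    have := congrArg det hgg'
    rw [det_mul, h, zero_mul, det_one] at this
    exact zero_ne_one this
  have hadj : g.adjugate = g.det • g' := by
    rw [← Matrix.mul_one g.adjugate, ← hgg', ← Matrix.mul_assoc, adjugate_mul, Matrix.smul_mul,
      Matrix.one_mul]
  -- The scalar `g.det⁻¹` cancels the determinant by which the adjugate differs from the inverse.
  refine ⟨g, fun i => g.det⁻¹ • (g' * x.1 i * g), hdet, funext fun i => ?_⟩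
  have hE1 : E * (g' * x.1 i * g) = g' * x.1 i * g := by
    refine Matrix.toLin'.injective (LinearMap.ext fun v => ?_)
    have hmem : x.1 i *ᵥ (g *ᵥ v) ∈ U := h1 (mulVec_mem_jointRange _ _ _)
    rw [← he] at hmem
    obtain ⟨w, hw, hw'⟩ := hmem
    have hw2 : g' *ᵥ (x.1 i *ᵥ (g *ᵥ v)) = w := by
      rw [← hw', hg'v]
      exact e.symm_apply_apply w
    simp only [toLin'_apply, ← mulVec_mulVec, hw2]
    exact headProj_mulVec_of_mem hw
  have hE2 : g' * x.1 i * g * E = 0 := by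
    refine Matrix.toLin'.injective (LinearMap.ext fun v => ?_)
    have hmem : g *ᵥ (E *ᵥ v) ∈ U := by
      rw [hgv, ← he]
      exact ⟨_, ⟨v, rfl⟩, rfl⟩
    simp only [Matrix.mul_assoc, toLin'_apply, map_zero, LinearMap.zero_apply]
    simp only [← mulVec_mulVec]
    rw [mem_jointKer.1 (h2 hmem) i, mulVec_zero]
  have hE3 : g' * x.1 i * g * (1 - E) = g' * x.1 i * g := by
    rw [mul_sub, hE2, sub_zero, mul_one]
  symm
  calc conjTuple E g (fun i => g.det⁻¹ • (g' * x.1 i * g)) i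
      = (g.det⁻¹ * g.det) • (g * (E * (g' * x.1 i * g) * (1 - E)) * g') := by
        simp only [conjTuple, hadj, Matrix.mul_smul, Matrix.smul_mul, smul_smul, Matrix.mul_assoc,
          mul_comm]
    _ = g * (g' * x.1 i * g) * g' := by rw [inv_mul_cancel₀ hdet, one_smul, hE1, hE3]
    _ = (g * g') * x.1 i * (g * g') := by simp only [Matrix.mul_assoc]
    _ = x.1 i := by rw [hgg', Matrix.one_mul, Matrix.mul_one]

theorem isPreirreducible_sandwich [Infinite K] [Nontrivial Λ]
    (hJ : ∀ a ∈ Ring.jacobson Λ, ∀ b ∈ Ring.jacobson Λ, a * b = 0) {s : ℕ} (hs : s ≤ d) :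
    IsPreirreducible (sandwich α d s) := by
  let R := MvPolynomial (Fin d × Fin d ⊕ Fin r × Fin d × Fin d) K
  let G : Matrix (Fin d) (Fin d) R := of fun a b => MvPolynomial.X (Sum.inl (a, b))
  let B : Fin r → Matrix (Fin d) (Fin d) R := fun i => of fun a b =>
    MvPolynomial.X (Sum.inr (i, a, b))
  let E : Matrix (Fin d) (Fin d) R := (headProj K d s).map (algebraMap K R)
  have hG : ∀ w, G.map (MvPolynomial.eval w) = of fun a b => w (Sum.inl (a, b)) := fun w => by
    ext; simp [G]
  have hB : ∀ w i, (B i).map (MvPolynomial.eval w) = of fun a b => w (Sum.inr (i, a, b)) :=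
    fun w i => by ext; simp [B]
  have hE : ∀ w, E.map (MvPolynomial.eval w) = headProj K d s := fun w => by
    ext; exact MvPolynomial.eval_C _
  have hφ : ∀ w i, (conjTuple E G B i).map (MvPolynomial.eval w) = conjTuple (headProj K d s)
      (of fun a b => w (Sum.inl (a, b))) (fun i => of fun a b => w (Sum.inr (i, a, b))) i := by
    intro w i
    rw [conjTuple_map, hE, hG]
    simp only [hB]
  have hδ : ∀ w, MvPolynomial.eval w G.det = (of fun a b => w (Sum.inl (a, b))).det := by
    intro w
    rw [RingHom.map_det, RingHom.mapMatrix_apply, hG]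
  have hcoords : ∀ (x : Rep α d) w, x.1 = conjTuple (headProj K d s)
      (of fun a b => w (Sum.inl (a, b))) (fun i => of fun a b => w (Sum.inr (i, a, b))) →
      x.coords = fun p => MvPolynomial.eval w (conjTuple E G B p.1 p.2.1 p.2.2) := by
    intro x w hx
    funext p
    rw [Rep.coords, hx, ← hφ, map_apply]
  refine isPreirreducible_of_parametrization (fun p => conjTuple E G B p.1 p.2.1 p.2.2) G.det ?_ ?_
  · intro x hx
    obtain ⟨g, b, hg, hxg⟩ := exists_conjTuple_eq hs hx
    let w : Fin d × Fin d ⊕ Fin r × Fin d × Fin d → K :=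
      Sum.elim (fun p => g p.1 p.2) fun p => b p.1 p.2.1 p.2.2
    exact ⟨w, by rw [hδ]; exact hg, hcoords x w hxg⟩
  · intro w hw
    rw [hδ] at hw
    obtain ⟨x, hx, hxg⟩ := exists_sandwich_eq_conjTuple (α := α) hJ hs hw
      fun i => of fun a b => w (Sum.inr (i, a, b))
    exact ⟨x, hx, hcoords x w hxg⟩

end Irreducibility

/-! ### Tops and simple summands in terms of joint ranges and kernels. -/

section Tops

theorem jacobson_smul_eq_zero {Λ S : Type*} [Ring Λ] [AddCommGroup S] [Module Λ S]
    [IsSimpleModule Λ S]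
    {a : Λ} (ha : a ∈ Ring.jacobson Λ) (m : S) : a • m = 0 :=
  Module.mem_annihilator.1 (IsSemisimpleModule.jacobson_le_annihilator Λ S ha) m

theorem jacobson_smul_top_eq_zero {Λ M : Type*} [Ring Λ] [AddCommGroup M] [Module Λ M] {a : Λ}
    (ha : a ∈ Ring.jacobson Λ) (m : Top Λ M) : a • m = 0 := by
  induction m using Submodule.Quotient.induction_on with
  | H m =>
    rw [← Submodule.Quotient.mk_smul, Submodule.Quotient.mk_eq_zero]
    exact Submodule.smul_mem_smul ha Submodule.mem_top

variable {K Λ : Type*} [Field K] [IsAlgClosed K] [Ring Λ] [Algebra K Λ] [FiniteDimensional K Λ]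
  [IsLocalRing Λ]

theorem exists_sub_algebraMap_mem_jacobson (K : Type*) [Field K] [IsAlgClosed K] [Algebra K Λ]
    [FiniteDimensional K Λ] (a : Λ) :
    ∃ c : K, a - algebraMap K Λ c ∈ Ring.jacobson Λ := by
  obtain ⟨c, hc⟩ := spectrum.nonempty_of_isAlgClosed_of_finiteDimensional K a
  refine ⟨c, ?_⟩
  rw [← neg_sub]
  exact neg_mem (show _ ∈ Ring.jacobson Λ from mem_radical_of_not_isUnit (K := K) hc)

/-- `K`-linear isomorphisms between modules that are annihilated by `J` are `Λ`-linear. -/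
def linearEquivOfRadicalSMulEqZero {M N : Type*} [AddCommGroup M] [Module Λ M] [Module K M]
    [IsScalarTower K Λ M] [AddCommGroup N] [Module Λ N] [Module K N] [IsScalarTower K Λ N]
    (hM : ∀ a ∈ Ring.jacobson Λ, ∀ m : M, a • m = 0)
    (hN : ∀ a ∈ Ring.jacobson Λ, ∀ n : N, a • n = 0) (e : M ≃ₗ[K] N) : M ≃ₗ[Λ] N :=
  { e with
    map_smul' := fun a m => by
      obtain ⟨c, hc⟩ := exists_sub_algebraMap_mem_jacobson K a
      have h1 := hM _ hc m
      have h2 := hN _ hc (e m)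
      rw [sub_smul, sub_eq_zero, algebraMap_smul] at h1 h2
      change e (a • m) = a • e m
      rw [h1, h2, map_smul] }

/-- As `Λ = K + J` and `J` kills `S`, the `Λ`-span of a nonzero vector is its `K`-span. -/
theorem finrank_simple {S : Type*} [AddCommGroup S] [Module Λ S] [IsSimpleModule Λ S]
    [Module K S] [IsScalarTower K Λ S] : Module.finrank K S = 1 := by
  have := IsSimpleModule.nontrivial Λ S
  obtain ⟨v, hv⟩ := exists_ne (0 : S)
  refine finrank_eq_one v hv fun w => ?_
  obtain ⟨a, rfl⟩ := IsSimpleModule.toSpanSingleton_surjective Λ hv w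
  obtain ⟨c, hc⟩ := exists_sub_algebraMap_mem_jacobson K a
  have h1 := jacobson_smul_eq_zero hc v
  rw [sub_smul, sub_eq_zero, algebraMap_smul] at h1
  exact ⟨c, by rw [LinearMap.toSpanSingleton_apply, h1]⟩

variable {r d : ℕ} {α : Module.Basis (Fin r) K (radical K Λ)}

instance (x : Rep α d) : Module K x.Mod := inferInstanceAs (Module K (Fin d → K))

instance (x : Rep α d) : FiniteDimensional K x.Mod :=
  inferInstanceAs (FiniteDimensional K (Fin d → K))

instance (x : Rep α d) : IsScalarTower K Λ x.Mod where
  smul_assoc c a v := by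
    rw [Rep.smul_def, Rep.smul_def, map_smul]
    exact smul_mulVec c (x.action a) (v : Fin d → K)

/-- The arrows span `J` over `K`, so `JM` is the sum of the images of their matrices. -/
theorem mem_jacobson_smul_top_iff (x : Rep α d) (v : x.Mod) :
    v ∈ Ring.jacobson Λ • (⊤ : Submodule Λ x.Mod) ↔ (v : Fin d → K) ∈ jointRange x.1 := by
  constructor
  · intro hv
    refine Submodule.smul_induction_on hv (fun a ha w _ => ?_)
      fun v w hv hw => (jointRange x.1).add_mem hv hw
    have h := congrArg (radical K Λ).subtype (α.sum_repr ⟨a, ha⟩)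
    rw [map_sum] at h
    simp only [map_smul, Submodule.subtype_apply] at h
    have hact : x.action a = ∑ i, α.repr ⟨a, ha⟩ i • x.1 i := by
      conv_lhs => rw [← h]
      simp only [map_sum, map_smul, Rep.action_arrow]
    have hmem : ∀ w : Fin d → K, x.action a *ᵥ w ∈ jointRange x.1 := fun w => by
      rw [hact, Matrix.sum_mulVec]
      refine Submodule.sum_mem _ fun i _ => ?_
      rw [smul_mulVec]
      exact Submodule.smul_mem _ _ (mulVec_mem_jointRange _ _ _)
    exact hmem w
  · intro hv
    have hle : jointRange x.1 ≤
        (Ring.jacobson Λ • (⊤ : Submodule Λ x.Mod)).restrictScalars K := by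
      refine jointRange_le.2 fun i w => ?_
      rw [← Rep.action_arrow]
      exact Submodule.smul_mem_smul (N := (⊤ : Submodule Λ x.Mod)) (n := (w : x.Mod))
        (α i).2 Submodule.mem_top
    exact hle hv

theorem finrank_top_add (x : Rep α d) :
    Module.finrank K (Top Λ x.Mod) + Module.finrank K (jointRange x.1) = d := by
  have h1 : (Ring.jacobson Λ • (⊤ : Submodule Λ x.Mod)).restrictScalars K = jointRange x.1 :=
    Submodule.ext fun v => mem_jacobson_smul_top_iff x v
  have h2 := Submodule.finrank_quotient_add_finrank
    ((Ring.jacobson Λ • (⊤ : Submodule Λ x.Mod)).restrictScalars K)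
  rw [(Submodule.Quotient.restrictScalarsEquiv K
    (Ring.jacobson Λ • (⊤ : Submodule Λ x.Mod))).finrank_eq] at h2
  have h3 : Module.finrank K x.Mod = d := Module.finrank_fin_fun K
  rw [h3] at h2
  rw [← h1]
  exact h2

theorem mem_repTop_iff {S : Type*} [AddCommGroup S] [Module Λ S] [IsSimpleModule Λ S] {t : ℕ}
    (x : Rep α d) :
    x ∈ RepTop α d (Fin t → S) ↔ t + Module.finrank K (jointRange x.1) = d := by
  -- `S` comes only as a `Λ`-module; its `K`-structure is restricted along `algebraMap`.
  let _ : Module K S := Module.compHom S (algebraMap K Λ)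
  have : IsScalarTower K Λ S := ⟨fun c a m => by
    rw [Algebra.smul_def, mul_smul]
    rfl⟩
  have hS : Module.finrank K S = 1 := finrank_simple (Λ := Λ)
  have : FiniteDimensional K S := Module.finite_of_finrank_eq_succ hS
  have ht : Module.finrank K (Fin t → S) = t := by
    rw [Module.finrank_pi_fintype]
    simp [hS]
  have htop := finrank_top_add x
  constructor
  · rintro ⟨e⟩
    rwa [(e.restrictScalars K).finrank_eq, ht] at htop
  · intro h
    refine ⟨linearEquivOfRadicalSMulEqZero (K := K) (fun a ha m => jacobson_smul_top_eq_zero ha m)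
      (fun a ha n => funext fun i => jacobson_smul_eq_zero ha (n i))
      (LinearEquiv.ofFinrankEq _ _ ?_)⟩
    omega

/-- A simple summand `N` is killed by `J`, so it lies in the joint kernel, which here is `JM`. But
`JM = JN'` lies in the complement `N'`, forcing `N = 0`. -/
theorem not_hasSimpleSummand_of_mem_balanced
    (hJ : ∀ a ∈ Ring.jacobson Λ, ∀ b ∈ Ring.jacobson Λ, a * b = 0) {s : ℕ} {x : Rep α d}
    (hx : x ∈ balanced α d s) : ¬ HasSimpleSummand Λ x.Mod := by
  rintro ⟨N, N', hc, hN⟩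
  have hker : ∀ v ∈ N, v ∈ Ring.jacobson Λ • (⊤ : Submodule Λ x.Mod) := by
    intro v hv
    rw [mem_jacobson_smul_top_iff, jointRange_eq_jointKer_of_mem_balanced hJ hx]
    refine mem_jointKer.2 fun i => ?_
    rw [← Rep.action_arrow]
    exact congrArg Subtype.val (jacobson_smul_eq_zero (α i).2 (⟨v, hv⟩ : N))
  have hle : Ring.jacobson Λ • (⊤ : Submodule Λ x.Mod) ≤ N' := by
    refine Submodule.smul_le.2 fun a ha v _ => ?_
    obtain ⟨n, hn, n', hn', rfl⟩ := Submodule.mem_sup.1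
      (show v ∈ N ⊔ N' from hc.sup_eq_top ▸ Submodule.mem_top)
    have h0 : a • n = 0 := congrArg Subtype.val (jacobson_smul_eq_zero ha (⟨n, hn⟩ : N))
    rw [smul_add, h0, zero_add]
    exact N'.smul_mem a hn'
  have hbot : N = ⊥ := hc.disjoint.eq_bot_of_le fun v hv => hle (hker v hv)
  have := IsSimpleModule.nontrivial Λ N
  exact (Submodule.nontrivial_iff_ne_bot.1 this) hbot

end Tops

/-! ### Components from nonempty open subsets of irreducible sets. -/

section Components

/-- Any irreducible `Z` containing `Y` has the nonempty open `O` as a dense subset, so `Z` is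
contained in the closure of `Y`. -/
theorem closure_mem_irreducibleComponents {X : Type*} [TopologicalSpace X] {O Y : Set X}
    (hO : IsOpen O) (hne : O.Nonempty) (hOY : O ⊆ Y) (hY : IsPreirreducible Y) :
    closure Y ∈ irreducibleComponents X := by
  refine ⟨isIrreducible_iff_closure.2 ⟨hne.mono hOY, hY⟩, fun Z hZ hYZ => ?_⟩
  have hOZ : O ⊆ Z := hOY.trans (subset_closure.trans hYZ)
  refine (subset_closure_inter_of_isPreirreducible_of_isOpen hZ.2 hO ?_).trans
    (closure_mono (Set.inter_subset_right.trans hOY))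
  rwa [Set.inter_eq_right.2 hOZ]

theorem closure_eq_of_isOpen_subset {X : Type*} [TopologicalSpace X] {O T Y : Set X}
    (hO : IsOpen O) (hne : O.Nonempty) (hOT : O ⊆ T) (hTY : T ⊆ Y) (hY : IsPreirreducible Y) :
    closure T = closure Y := by
  refine (closure_mono hTY).antisymm (closure_minimal ?_ isClosed_closure)
  have hOY := hOT.trans hTY
  refine (subset_closure_inter_of_isPreirreducible_of_isOpen hY hO ?_).trans
    (closure_mono (Set.inter_subset_right.trans hOT))
  rwa [Set.inter_eq_right.2 hOY]

end Components

theorem ceil_div_eq {r d u : ℕ} (hu : IsLeast {n : ℕ | (d : ℤ) - n ≤ r * n} u) :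
    u = ⌈(d : ℚ) / (r + 1)⌉₊ := by
  have hpos : (0 : ℚ) < r + 1 := by positivity
  have hiff : ∀ n : ℕ, (d : ℚ) / (r + 1) ≤ n ↔ (d : ℤ) - n ≤ r * n := fun n => by
    rw [div_le_iff₀ hpos, sub_le_iff_le_add]
    have : (n : ℚ) * (r + 1) = ((r * n + n : ℤ) : ℚ) := by push_cast; ring
    rw [this]
    exact_mod_cast Iff.rfl
  refine le_antisymm (hu.2 ((hiff _).1 (Nat.le_ceil _))) (Nat.ceil_le.2 ((hiff _).2 hu.1))

end LocalRep

/-! ### The main theorem. -/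

theorem theorem3p12 {K Λ S : Type*} [Field K] [IsAlgClosed K] [Ring Λ] [Algebra K Λ]
    [FiniteDimensional K Λ] [IsLocalRing Λ]
    (hJ : ∀ a ∈ Ring.jacobson Λ, ∀ b ∈ Ring.jacobson Λ, a * b = 0)
    {r : ℕ} (hr : 2 ≤ r) (α : Module.Basis (Fin r) K (LocalRep.radical K Λ))
    [AddCommGroup S] [Module Λ S] [IsSimpleModule Λ S]
    (d : ℕ) (hd : 2 ≤ d) (u : ℕ) (hu : IsLeast {n : ℕ | (d : ℤ) - n ≤ r * n} u) :
    u = ⌈(d : ℚ) / (r + 1)⌉₊ ∧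
    Set.BijOn (fun t : ℕ => closure (LocalRep.RepTop α d (Fin t → S)))
      {t : ℕ | u ≤ t ∧ t ≤ d - u} (irreducibleComponents (LocalRep.Rep α d)) ∧
    ∀ C ∈ irreducibleComponents (LocalRep.Rep α d),
      LocalRep.Generically C fun x => ¬ LocalRep.HasSimpleSummand Λ x.Mod := by
  open LocalRep in
  have : Infinite K := IsAlgClosed.instInfinite
  have hu1 : d ≤ r * u + u := by
    have := hu.1
    simp only [Set.mem_ofPred_eq] at this
    zify
    linarith
  have hu2 : ∀ n, d ≤ r * n + n → u ≤ n := fun n hn => hu.2 (by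
    simp only [Set.mem_ofPred_eq]
    zify at hn
    linarith)
  have hu0 : 0 < u := Nat.pos_of_ne_zero fun h => by
    rw [h] at hu1
    omega
  -- This uses `r ≥ 2`: already `3 * (d / 2) ≥ d` when `d ≥ 2`, so `d / 2` is a competitor for `u`.
  have hud : 2 * u ≤ d := by
    have : u ≤ d / 2 := by
      refine hu2 _ ?_
      have : 2 * (d / 2) ≤ r * (d / 2) := Nat.mul_le_mul_right _ hr
      omega
    omega
  have hbound : ∀ n, u ≤ n → d ≤ r * n + n := fun n hn =>
    hu1.trans (add_le_add (Nat.mul_le_mul_left r hn) hn)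
  -- The interval is stable under `s ↦ d - s`; the bound at `s` controls the kernel and the one at
  -- `d - s` the range.
  have hne : ∀ s, u ≤ s → s ≤ d - u → (balanced α d s).Nonempty := fun s h1 h2 =>
    balanced_nonempty hJ (by omega) (by omega) (by omega)
      (by have := hbound (d - s) (by omega); omega) (hbound s h1)
  have hirr : ∀ s, s ≤ d - u → IsPreirreducible (sandwich α d s) := fun s h2 =>
    isPreirreducible_sandwich hJ (by omega)
  have hOT : ∀ s, s ≤ d → balanced α d s ⊆ RepTop α d (Fin (d - s) → S) := fun s hs x hx => by
    rw [mem_repTop_iff, finrank_jointRange_of_mem_balanced hJ hx]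
    omega
  have hTY : ∀ s, s ≤ d → RepTop α d (Fin (d - s) → S) ⊆ sandwich α d s := fun s hs x hx => by
    have h := (mem_repTop_iff x).1 hx
    have h' : Module.finrank K (jointRange x.1) = s := by omega
    simpa only [h'] using mem_sandwich_finrank_jointRange hJ x
  have hcl : ∀ t, u ≤ t → t ≤ d - u →
      closure (RepTop α d (Fin t → S)) = closure (sandwich α d (d - t)) := by
    intro t h1 h2
    have hdt : d - (d - t) = t := by omega
    have h := closure_eq_of_isOpen_subset (isOpen_balanced (d - t))
      (hne (d - t) (by omega) (by omega)) (hOT (d - t) (by omega)) (hTY (d - t) (by omega))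
      (hirr (d - t) (by omega))
    rwa [hdt] at h
  have hcomp : ∀ s, u ≤ s → s ≤ d - u →
      closure (sandwich α d s) ∈ irreducibleComponents (Rep α d) := fun s h1 h2 =>
    closure_mem_irreducibleComponents (isOpen_balanced s) (hne s h1 h2)
      (balanced_subset_sandwich hJ s) (hirr s h2)
  have hdense : ∀ s, u ≤ s → s ≤ d - u →
      closure (balanced α d s) = closure (sandwich α d s) := fun s h1 h2 =>
    closure_eq_of_isOpen_subset (isOpen_balanced s) (hne s h1 h2) subset_rfl
      (balanced_subset_sandwich hJ s) (hirr s h2)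
  have hall : ∀ C ∈ irreducibleComponents (Rep α d),
      ∃ s, u ≤ s ∧ s ≤ d - u ∧ closure (sandwich α d s) = C := by
    classical
    intro C hC
    -- The closed sandwiches form a finite cover, so an irreducible set lies in one of them;
    -- maximality then gives equality.
    obtain ⟨Z, hZ, hCZ⟩ := isIrreducible_iff_sUnion_isClosed.1 hC.1
      ((Finset.Icc u (d - u)).image fun s => closure (sandwich α d s))
      (fun Z hZ => by
        obtain ⟨s, -, rfl⟩ := Finset.mem_image.1 hZ
        exact isClosed_closure)
      (fun x _ => by
        obtain ⟨s, h1, h2, hx⟩ := exists_mem_sandwich hJ hu2 hud x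
        exact Set.mem_sUnion.2 ⟨_, Finset.mem_coe.2
          (Finset.mem_image_of_mem _ (Finset.mem_Icc.2 ⟨h1, h2⟩)), subset_closure hx⟩)
    obtain ⟨s, hs, rfl⟩ := Finset.mem_image.1 hZ
    obtain ⟨h1, h2⟩ := Finset.mem_Icc.1 hs
    exact ⟨s, h1, h2, (hC.2 (hcomp s h1 h2).1 hCZ).antisymm hCZ⟩
  refine ⟨ceil_div_eq hu, ⟨?_, ?_, ?_⟩, ?_⟩
  · rintro t ⟨h1, h2⟩
    simp only [hcl t h1 h2]
    exact hcomp _ (by omega) (by omega)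
  · rintro t ⟨h1, h2⟩ t' ⟨h1', h2'⟩ h
    simp only [hcl t h1 h2, hcl t' h1' h2', ← hdense (d - t) (by omega) (by omega),
      ← hdense (d - t') (by omega) (by omega)] at h
    by_contra htt'
    obtain ⟨x, hx⟩ := hne (d - t) (by omega) (by omega)
    have hx' : x ∈ closure (balanced α d (d - t')) := h ▸ subset_closure hx
    -- An open neighbourhood of a point in the closure of the other balanced locus would meet that
    -- locus, contradicting disjointness.
    obtain ⟨y, hy, hy'⟩ := mem_closure_iff.1 hx' _ (isOpen_balanced (d - t)) hx
    exact Set.disjoint_left.1 (disjoint_balanced hJ (by omega)) hy hy'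
  · intro C hC
    obtain ⟨s, h1, h2, rfl⟩ := hall C hC
    have hds : d - (d - s) = s := by omega
    refine ⟨d - s, ⟨by omega, by omega⟩, ?_⟩
    simp only [hcl (d - s) (by omega) (by omega), hds]
  · intro C hC
    obtain ⟨s, h1, h2, rfl⟩ := hall C hC
    refine ⟨Subtype.val ⁻¹' balanced α d s, (isOpen_balanced s).preimage continuous_subtype_val,
      ?_, fun x hx => not_hasSimpleSummand_of_mem_balanced hJ hx⟩
    rw [Subtype.dense_iff, Subtype.image_preimage_coe, Set.inter_eq_right.2
      ((balanced_subset_sandwich hJ s).trans subset_closure), hdense s h1 h2]
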